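/- Let $R$ be a (not necessarily commutative) $2$-fir, i.e. a ring with $1$ in which every right ideal generated by at most two elements is free of unique rank (in particular $R$ is a domain). An atom of $R$ is a nonzero nonunit that is not a product of two nonunits; $\mathcal F$ denotes the set of all units and all finite products of atoms. An element $f\in\mathcal F$ is called fully reducible if $Rf=\bigcap_{i=1}^{n}Rp_i$ for finitely many atoms $p_1,\dots,p_n$. For $a\in R$ put $V(a)=\{p \text{ an atom} : a\in Rp\}$, $V'(a)=\{p\text{ an atom} : a\in pR\}$ and $\mathbb I_R(Ra)=\{f\in R : af\in Ra\}$. A set $\Delta\subseteq\mathcal F$ of nonunits is $F$-algebraic if $\bigcap_{\delta\in\Delta}R\delta\neq 0$ (the empty intersection being $R$). An element $d\in\mathcal F$ is $F$-dependent on an $F$-algebraic set $\Delta$ if $\Delta\cup\{d\}$ is $F$-algebraic and there is a finite subset $\Gamma\subseteq\Delta$ with $Rd+\bigcap_{\gamma\in\Gamma}R\gamma\neq R$. An $F$-algebraic set $B$ is $F$-independent if no $\beta\in B$ is $F$-dependent on $B\setminus\{\beta\}$; an $F$-basis of an $F$-algebraic set $\Delta$ is an $F$-independent subset $B\subseteq\Delta$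 such that every element of $\Delta$ is $F$-dependent on $B$. **Theorem.** For nonunits $a,b\in R$ the following are equivalent: 1. $ab$ is fully reducible. 2. $a,b$ are fully reducible and $R/Rab\cong R/Ra\oplus R/Rb$ as left $R$-modules. 3. $a,b$ are fully reducible and $1\in Ra+bR$. 4. $a,b$ are fully reducible and $pb$ is fully reducible for all $p\in V(a)$. 5. $a,b$ are fully reducible and, for every $F$-basis $B$ of $V(a)$, $pb$ is fully reducible for all $p\in B$. 6. $a,b$ are fully reducible and there is an $F$-basis $B$ of $V(a)$ such that $pb$ is fully reducible for all $p\in B$. 7. $a,b$ are fully reducible and $pq$ is fully reducible for all $p\in V(a)$ and all $q\in V'(b)$. 8. $a,b$ are fully reducible and $\mathbb I_R(Ra)\subseteq Ra+bR$. -/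

import Mathlib

namespace TwoFir

variable {R : Type*} [Ring R]

/-- `R` is a 2-fir: every right ideal generated by at most two elements is free of unique rank.
Right ideals are the `Rᵐᵒᵖ`-submodules of `R`. A finitely generated free module over a nonzero ring
has only finite bases, and over the zero ring every finite type indexes a basis, so "free of unique
rank" says that there is exactly one natural number `n` for which a basis with `n` elements exists.
(In particular the zero ring is not a 2-fir.) -/
def IsTwoFir (R : Type*) [Ring R] : Prop :=
  ∀ x y : R, ∃! n : ℕ,
    Nonempty (Module.Basis (Fin n) Rᵐᵒᵖ (Submodule.span Rᵐᵒᵖ ({x, y} : Set R)))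

/-- The principal left ideal `R a`. -/
def leftIdeal (a : R) : Submodule R R := Submodule.span R {a}

/-- `𝓕`, the elements of finite length: the units and the finite products of atoms.
(An atom is a nonunit that is not a product of two nonunits, i.e. `Irreducible`; in a nonzero ring
this excludes `0`.) -/
def finiteLength (R : Type*) [Ring R] : Set R :=
  {x | IsUnit x ∨ ∃ l : List R, (∀ p ∈ l, Irreducible p) ∧ l.prod = x}

/-- `f` is fully reducible: `f` has finite length and `R f` is a finite intersection
`R p₁ ∩ ⋯ ∩ R pₙ` with atoms `pᵢ`. -/
def FullyReducible (f : R) : Prop :=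
  f ∈ finiteLength R ∧
    ∃ (n : ℕ) (p : Fin n → R), (∀ i, Irreducible (p i)) ∧ leftIdeal f = ⨅ i, leftIdeal (p i)

/-- `Δ` is `F`-algebraic: it consists of nonunits of finite length and the left ideals `R δ`,
`δ ∈ Δ`, have nonzero intersection (the empty intersection being `R`). -/
def FAlgebraic (Δ : Set R) : Prop :=
  (∀ δ ∈ Δ, δ ∈ finiteLength R ∧ ¬ IsUnit δ) ∧ (⨅ δ ∈ Δ, leftIdeal δ) ≠ ⊥

/-- `d` is `F`-dependent on `Δ`: `d` has finite length, `Δ ∪ {d}` is `F`-algebraic and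
`R d + ⋂_{γ ∈ Γ} R γ ≠ R` for some finite subset `Γ` of `Δ`. -/
def FDependent (d : R) (Δ : Set R) : Prop :=
  d ∈ finiteLength R ∧ FAlgebraic (Δ ∪ {d}) ∧
    ∃ Γ : Finset R, (Γ : Set R) ⊆ Δ ∧ leftIdeal d ⊔ (⨅ γ ∈ Γ, leftIdeal γ) ≠ ⊤

/-- An `F`-algebraic set is `F`-independent if none of its elements is `F`-dependent on the
others. -/
def FIndependent (Δ : Set R) : Prop :=
  FAlgebraic Δ ∧ ∀ δ ∈ Δ, ¬ FDependent δ (Δ \ {δ})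

/-- `B` is an `F`-basis of the `F`-algebraic set `Δ`. -/
def IsFBasis (B Δ : Set R) : Prop :=
  FAlgebraic Δ ∧ B ⊆ Δ ∧ FIndependent B ∧ ∀ d ∈ Δ, FDependent d B

/-- `V(a)`: the atoms `p` with `a ∈ R p`. -/
def V (a : R) : Set R := {p | Irreducible p ∧ a ∈ leftIdeal p}

/-- `V'(a)`: the atoms `p` with `a ∈ p R`. -/
def V' (a : R) : Set R := {p | Irreducible p ∧ ∃ c : R, a = p * c}

/-- `I_R(R a)`: the elements `f` with `a f ∈ R a`. -/
def idealizer (a : R) : Set R := {f | a * f ∈ leftIdeal a}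

/-- `R a + b R` (an additive subgroup of `R`), as a set. -/
def leftAddRight (a b : R) : Set R := {x | ∃ u v : R, x = u * a + b * v}

end TwoFir

/-! Freeness of right ideals enters only through a left-handed consequence, `LeftBezout`: if `Rx`
and `Ry` have a nonzero common element, then `Rx + Ry` and `Rx ∩ Ry` are principal. Hence, inside an
interval `[Rw, R]` with `w ≠ 0`, an atom `p` and an element `y` satisfy either `y ∈ Rp` or `Rp + Ry
= R`, and the preimage of `Rp` under right multiplication by `y` is `R` or `Rq` with `q` an atom.

If `ab` is fully reducible, `Rb` has a complement over `Rab` (`exists_complement`), and this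
complement yields `1 ∈ Ra + bR`. Such a relation splits `R/Rab` as `R/Ra ⊕ R/Rb`. A splitting
exhibits `Rab` as an intersection of preimages of `Ra` and `Rb`, hence of atomic left ideals. This
is 1 → 3 → 2 → 1, and 8 is equivalent to 3 because 1 lies in the idealizer.

For the atomwise conditions, an `F`-basis of `V(a)` contains finitely many atoms cutting out `Ra`,
so `Rab` is the intersection of `Rb` with finitely many `Rpb`. Condition 7 reduces to 4 by induction
on the length of `b`, gluing relations for coprime left factors
(`one_mem_leftAddRight_of_forall_atom`). -/

namespace TwoFir

/-! ### Consequences of the rank condition for right ideals -/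

section RightModules

variable {R : Type*} [Ring R]

/-- A surjection with a linear section splits its source. -/
theorem exists_equiv_prod_ker {S M N : Type*} [Ring S] [AddCommGroup M] [AddCommGroup N]
    [Module S M] [Module S N] (f : M →ₗ[S] N) (σ : N →ₗ[S] M) (h : ∀ x, f (σ x) = x) :
    Nonempty ((N × LinearMap.ker f) ≃ₗ[S] M) :=
  ⟨{ toFun := fun z => σ z.1 + z.2
     map_add' := fun z w => by simp; abel
     map_smul' := fun c z => by simp
     invFun := fun m => (f m, ⟨m - σ (f m), by simp [h]⟩)
     left_inv := fun z => by ext <;> simp [h, LinearMap.mem_ker.1 z.2.2]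
     right_inv := fun m => by simp }⟩

/-- A ring as a right module over itself is the regular module of the opposite ring. -/
def opEquiv (R : Type*) [Ring R] : R ≃ₗ[Rᵐᵒᵖ] Rᵐᵒᵖ where
  toFun := MulOpposite.op
  invFun := MulOpposite.unop
  map_add' _ _ := rfl
  map_smul' _ _ := rfl
  left_inv _ := rfl
  right_inv _ := rfl

/-- Left multiplication by `x`, as a map of right modules. -/
def mulLeftOp (x : R) : R →ₗ[Rᵐᵒᵖ] R where
  toFun r := x * r
  map_add' := mul_add x
  map_smul' c r := by simp [mul_assoc]

@[simp] theorem mulLeftOp_apply (x r : R) : mulLeftOp x r = x * r := rfl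

theorem mem_span_pair_op {x y z : R} :
    z ∈ Submodule.span Rᵐᵒᵖ ({x, y} : Set R) ↔ ∃ r s : R, x * r + y * s = z := by
  rw [Submodule.mem_span_pair]
  constructor
  · rintro ⟨r, s, h⟩
    exact ⟨r.unop, s.unop, h⟩
  · rintro ⟨r, s, h⟩
    exact ⟨MulOpposite.op r, MulOpposite.op s, h⟩

theorem IsTwoFir.rank_one (hR : IsTwoFir R) {n : ℕ} (b : Module.Basis (Fin n) Rᵐᵒᵖ R) : n = 1 := by
  have htop : Submodule.span Rᵐᵒᵖ ({1, 1} : Set R) = ⊤ := by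
    refine eq_top_iff.2 fun z _ => mem_span_pair_op.2 ⟨z, 0, by simp⟩
  let e : R ≃ₗ[Rᵐᵒᵖ] Submodule.span Rᵐᵒᵖ ({1, 1} : Set R) :=
    (Submodule.topEquiv.symm).trans (LinearEquiv.ofEq _ _ htop.symm)
  refine (hR 1 1).unique ⟨b.map e⟩ ⟨Module.Basis.map ?_ e⟩
  exact (Module.Basis.singleton (Fin 1) Rᵐᵒᵖ).map (opEquiv R).symm

/-- The rank of the free right module of rank two is unique if that module embeds into the ring. -/
theorem IsTwoFir.rank_two (hR : IsTwoFir R) {w : Fin 2 → R} (hw : LinearIndependent Rᵐᵒᵖ w)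
    {n : ℕ} (b : Module.Basis (Fin n) Rᵐᵒᵖ (R × R)) : n = 2 := by
  have hspan : Submodule.span Rᵐᵒᵖ (Set.range w) = Submodule.span Rᵐᵒᵖ ({w 0, w 1} : Set R) := by
    congr 1
    ext z
    simp [Fin.exists_fin_two, eq_comm]
  let c : Module.Basis (Fin 2) Rᵐᵒᵖ (Submodule.span Rᵐᵒᵖ ({w 0, w 1} : Set R)) :=
    (Module.Basis.span hw).map (LinearEquiv.ofEq _ _ hspan)
  let d₁ : Module.Basis (Fin 1) Rᵐᵒᵖ R :=
    (Module.Basis.singleton (Fin 1) Rᵐᵒᵖ).map (opEquiv R).symm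
  let d : Module.Basis (Fin 2) Rᵐᵒᵖ (R × R) := (d₁.prod d₁).reindex finSumFinEquiv
  exact (hR (w 0) (w 1)).unique ⟨b.map (d.equiv c (Equiv.refl _))⟩ ⟨c⟩

theorem IsTwoFir.nontrivial (hR : IsTwoFir R) : Nontrivial R := by
  by_contra h
  rw [not_nontrivial_iff_subsingleton] at h
  have := hR.rank_one (n := 0) (Module.Basis.empty R)
  omega

/-- The free module `xR` splits off `R`, and the annihilator of `x` is `(1 - e)R`, hence also free.
The two ranks add up to 1, so `x ≠ 0` leaves rank 0 for the annihilator. -/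
theorem IsTwoFir.noZeroDivisors (hR : IsTwoFir R) : NoZeroDivisors R := by
  refine ⟨fun {x y} hxy => ?_⟩
  by_contra! hne
  obtain ⟨n, ⟨B⟩, -⟩ := hR x x
  let I := Submodule.span Rᵐᵒᵖ ({x, x} : Set R)
  let f : R →ₗ[Rᵐᵒᵖ] I := (mulLeftOp x).codRestrict I fun r =>
    mem_span_pair_op.2 ⟨r, 0, by simp⟩
  have hf : Function.Surjective f := by
    rintro ⟨z, hz⟩
    obtain ⟨r, s, rfl⟩ := mem_span_pair_op.1 hz
    exact ⟨r + s, Subtype.ext (by simp [f])⟩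
  have : Module.Projective Rᵐᵒᵖ I := Module.Projective.of_basis B
  obtain ⟨σ, hσ⟩ := Module.projective_lifting_property f LinearMap.id hf
  replace hσ : ∀ z, f (σ z) = z := fun z => LinearMap.congr_fun hσ z
  obtain ⟨E⟩ := exists_equiv_prod_ker f σ hσ
  set e := σ (f 1) with he
  have hker : LinearMap.ker f = Submodule.span Rᵐᵒᵖ ({1 - e, 1 - e} : Set R) := by
    have hfr : ∀ r : R, f r = MulOpposite.op r • f 1 := fun r => by
      rw [← map_smul]; simp
    ext r
    rw [mem_span_pair_op, LinearMap.mem_ker]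
    constructor
    · intro hr
      have h0 : e * r = 0 := by
        have : σ (f r) = e * r := by rw [hfr r, map_smul]; simp [he]
        rw [← this, hr, map_zero]
      exact ⟨r, 0, by simp [sub_mul, h0]⟩
    · rintro ⟨r, s, rfl⟩
      have h1 : f (1 - e) = 0 := by rw [map_sub, he, hσ, sub_self]
      have h2 : ∀ r, f ((1 - e) * r) = 0 := fun r => by
        have := map_smul f (MulOpposite.op r) (1 - e)
        rw [h1, smul_zero] at this
        simpa using this
      rw [map_add, h2, h2, add_zero]
  obtain ⟨k, ⟨C⟩, -⟩ := hR (1 - e) (1 - e)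
  have hnk := hR.rank_one
    (((B.prod (C.map (LinearEquiv.ofEq _ _ hker.symm))).reindex finSumFinEquiv).map E)
  have hx : x ∈ I := mem_span_pair_op.2 ⟨1, 0, by simp⟩
  have hn : n ≠ 0 := by
    rintro rfl
    have : Subsingleton I := B.repr.toEquiv.subsingleton
    exact hne.1 (congrArg Subtype.val (Subsingleton.elim (⟨x, hx⟩ : I) 0))
  have hk : k = 0 := by omega
  subst hk
  have hs : Subsingleton (Submodule.span Rᵐᵒᵖ ({1 - e, 1 - e} : Set R)) :=
    C.repr.toEquiv.subsingleton
  have hy : y ∈ Submodule.span Rᵐᵒᵖ ({1 - e, 1 - e} : Set R) := by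
    rw [← hker, LinearMap.mem_ker]
    exact Subtype.ext hxy
  exact hne.2 (congrArg Subtype.val
    (Subsingleton.elim (⟨y, hy⟩ : Submodule.span Rᵐᵒᵖ ({1 - e, 1 - e} : Set R)) 0))

theorem exists_generator_of_basis {I : Submodule Rᵐᵒᵖ R}
    (B : Module.Basis (Fin 1) Rᵐᵒᵖ I) : ∃ d ∈ I, ∀ z ∈ I, ∃ r, z = d * r := by
  refine ⟨B 0, (B 0).2, fun z hz => ⟨(B.repr ⟨z, hz⟩ 0).unop, ?_⟩⟩
  have := congrArg Subtype.val (B.sum_repr ⟨z, hz⟩)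
  simpa using this.symm

theorem exists_linearIndependent_pair {I : Submodule Rᵐᵒᵖ R} {n : ℕ}
    (B : Module.Basis (Fin n) Rᵐᵒᵖ I) (hn : 2 ≤ n) :
    ∃ w : Fin 2 → R, LinearIndependent Rᵐᵒᵖ w :=
  ⟨fun i => B (Fin.castLE hn i),
    (B.linearIndependent.map' I.subtype (Submodule.ker_subtype I)).comp _
      (Fin.castLE_injective hn)⟩

/-- Two elements with a common right multiple generate a principal right ideal, and the common
right multiples form a principal right ideal. -/
theorem IsTwoFir.right_gcd_lcm (hR : IsTwoFir R) {x y s t : R} (h : x * s = y * t)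
    (h0 : x * s ≠ 0) :
    (∃ d x' y' u v, x = d * x' ∧ y = d * y' ∧ d = x * u + y * v) ∧
      ∃ x₁ y₁, x * x₁ = y * y₁ ∧ ∀ r q, x * r = y * q → ∃ z, r = x₁ * z := by
  have := hR.noZeroDivisors
  have hx : x ≠ 0 := left_ne_zero_of_mul h0
  have hy : y ≠ 0 := left_ne_zero_of_mul (h ▸ h0)
  obtain ⟨n, ⟨B⟩, -⟩ := hR x y
  let I := Submodule.span Rᵐᵒᵖ ({x, y} : Set R)
  let g : R × R →ₗ[Rᵐᵒᵖ] R := (mulLeftOp x).coprod (mulLeftOp y)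
  let f : R × R →ₗ[Rᵐᵒᵖ] I := g.codRestrict I fun r =>
    mem_span_pair_op.2 ⟨r.1, r.2, rfl⟩
  have hfg : ∀ r, (f r : R) = x * r.1 + y * r.2 := fun r => rfl
  have hf : Function.Surjective f := by
    rintro ⟨z, hz⟩
    obtain ⟨r, s, rfl⟩ := mem_span_pair_op.1 hz
    exact ⟨(r, s), rfl⟩
  have : Module.Projective Rᵐᵒᵖ I := Module.Projective.of_basis B
  obtain ⟨σ, hσ⟩ := Module.projective_lifting_property f LinearMap.id hf
  replace hσ : ∀ z, f (σ z) = z := fun z => LinearMap.congr_fun hσ z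
  obtain ⟨E⟩ := exists_equiv_prod_ker f σ hσ
  let π : R × R →ₗ[Rᵐᵒᵖ] R × R := LinearMap.id - σ.comp f
  have hπ : ∀ r, f (π r) = 0 := fun r => by simp [π, hσ]
  have hπ' : ∀ r, f r = 0 → π r = r := fun r hr => by simp [π, hr]
  let θ : R × R →ₗ[Rᵐᵒᵖ] R := (mulLeftOp x).comp (LinearMap.fst Rᵐᵒᵖ R R)
  let φ : LinearMap.ker f →ₗ[Rᵐᵒᵖ] R := θ.comp (LinearMap.ker f).subtype
  have hφ : Function.Injective φ := by
    rw [injective_iff_map_eq_zero]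
    rintro ⟨⟨r, q⟩, hrq⟩ h1
    have h2 : x * r = 0 := h1
    have h3 : x * r + y * q = 0 := congrArg Subtype.val (LinearMap.mem_ker.1 hrq)
    rw [h2, zero_add] at h3
    have hr := (mul_eq_zero.1 h2).resolve_left hx
    have hq := (mul_eq_zero.1 h3).resolve_left hy
    simp [hr, hq]
  have hdec : ∀ r q : R,
      ((r, q) : R × R) = MulOpposite.op r • ((1, 0) : R × R) + MulOpposite.op q • (0, 1) :=
    fun r q => by simp
  -- The map `φ` identifies `ker f` with `xR ∩ yR`. The projection `π` of `R²` onto `ker f` shows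
  -- that this right ideal has two generators, so it is free as well.
  have hrange : LinearMap.range φ =
      Submodule.span Rᵐᵒᵖ ({θ (π (1, 0)), θ (π (0, 1))} : Set R) := by
    apply le_antisymm
    · rintro _ ⟨⟨⟨r, q⟩, hrq⟩, rfl⟩
      refine Submodule.mem_span_pair.2 ⟨MulOpposite.op r, MulOpposite.op q, ?_⟩
      change _ = θ (r, q)
      conv_rhs => rw [← hπ' (r, q) hrq, hdec r q]
      simp only [map_add, map_smul]
    · rw [Submodule.span_le]
      rintro z (rfl | rfl)
      · exact ⟨⟨π (1, 0), hπ _⟩, rfl⟩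
      · exact ⟨⟨π (0, 1), hπ _⟩, rfl⟩
  obtain ⟨k, ⟨C⟩, -⟩ := hR (θ (π (1, 0))) (θ (π (0, 1)))
  let C' := C.map (LinearEquiv.ofEq _ _ hrange.symm)
  let D := C'.map (LinearEquiv.ofInjective φ hφ).symm
  let T := ((B.prod D).reindex finSumFinEquiv).map E
  have hn0 : n ≠ 0 := by
    rintro rfl
    have : Subsingleton I := B.repr.toEquiv.subsingleton
    have hxI : x ∈ I := mem_span_pair_op.2 ⟨1, 0, by simp⟩
    exact hx (congrArg Subtype.val (Subsingleton.elim (⟨x, hxI⟩ : I) 0))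
  have hk0 : k ≠ 0 := by
    rintro rfl
    have : Subsingleton (LinearMap.ker f) := D.repr.toEquiv.subsingleton
    have hst : (s, -t) ∈ LinearMap.ker f := by
      rw [LinearMap.mem_ker]
      exact Subtype.ext (by simp [hfg, h])
    have h1 := congrArg Subtype.val
      (Subsingleton.elim (⟨(s, -t), hst⟩ : LinearMap.ker f) 0)
    exact right_ne_zero_of_mul h0 (congrArg Prod.fst h1)
  -- Here `R²` has a basis of size `n + k` with `n, k ≥ 1`. Were one of them at least 2, `R²` would
  -- embed in `R`; its rank would then be unique, so `n + k = 2`, a contradiction.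
  have hn1 : n = 1 := by
    by_contra hn1
    obtain ⟨w, hw⟩ := exists_linearIndependent_pair B (by omega)
    have := hR.rank_two hw T
    omega
  have hk1 : k = 1 := by
    by_contra hk1
    obtain ⟨w, hw⟩ := exists_linearIndependent_pair C (by omega)
    have := hR.rank_two hw T
    omega
  subst hn1 hk1
  constructor
  · obtain ⟨d, hd, hgen⟩ := exists_generator_of_basis B
    obtain ⟨u, v, huv⟩ := mem_span_pair_op.1 hd
    obtain ⟨x', hx'⟩ := hgen x (mem_span_pair_op.2 ⟨1, 0, by simp⟩)
    obtain ⟨y', hy'⟩ := hgen y (mem_span_pair_op.2 ⟨0, 1, by simp⟩)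
    exact ⟨d, x', y', u, v, hx', hy', huv.symm⟩
  · obtain ⟨d, hd, hgen⟩ := exists_generator_of_basis C'
    obtain ⟨⟨⟨x₁, y₁⟩, hk⟩, rfl⟩ := hd
    have hxy : x * x₁ + y * y₁ = 0 := congrArg Subtype.val (LinearMap.mem_ker.1 hk)
    refine ⟨x₁, -y₁, by rw [mul_neg]; exact eq_neg_of_add_eq_zero_left hxy, fun r q hrq => ?_⟩
    have hmem : x * r ∈ LinearMap.range φ :=
      ⟨⟨(r, -q), LinearMap.mem_ker.2 (Subtype.ext (by simp [hfg, hrq]))⟩, rfl⟩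
    obtain ⟨z, hz⟩ := hgen _ hmem
    refine ⟨z, mul_left_cancel₀ hx ?_⟩
    rw [hz, ← mul_assoc]
    rfl

end RightModules

/-- Elements `x`, `y` with a nonzero common left multiple can be written `x = x₁ z`, `y = y₁ z`
with `R x₁ + R y₁ = R` and `R x₁ ∩ R y₁` principal. -/
class LeftBezout (R : Type*) [Ring R] : Prop extends IsDomain R where
  exists_coprime : ∀ {x y s t : R}, s * x = t * y → s * x ≠ 0 →
    ∃ z x₁ y₁ g h s' t' : R, x = x₁ * z ∧ y = y₁ * z ∧ g * x₁ + h * y₁ = 1 ∧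
      s' * x₁ = t' * y₁ ∧ ∀ p q, p * x₁ = q * y₁ → ∃ c, p = c * s'

/-- Cancel the left gcd of `s` and `t` to get `s'u + t'v = 1`; the least common right multiple `s'x₁
= t'y₁` then gives `x = x₁z`, `y = y₁z`. Multiplying `s'u + t'v = 1` on the right by `s'` and by
`t'` produces two more common right multiples of `s'` and `t'`, whose cofactors are `g` and `h`. -/
theorem IsTwoFir.leftBezout {R : Type*} [Ring R] (hR : IsTwoFir R) : LeftBezout R := by
  have := hR.noZeroDivisors
  have := hR.nontrivial
  have : IsDomain R := NoZeroDivisors.to_isDomain R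
  refine ⟨fun {x y s t} hst h0 => ?_⟩
  obtain ⟨d, s', t', u, v, rfl, rfl, hd⟩ := (hR.right_gcd_lcm hst h0).1
  have hd0 : d ≠ 0 := left_ne_zero_of_mul (left_ne_zero_of_mul h0)
  have huv : s' * u + t' * v = 1 := by
    refine mul_left_cancel₀ hd0 ?_
    rw [mul_add, ← mul_assoc, ← mul_assoc, ← hd, mul_one]
  have hst' : s' * x = t' * y := mul_left_cancel₀ hd0 (by simpa only [mul_assoc] using hst)
  have h0' : s' * x ≠ 0 := by
    rw [mul_assoc] at h0
    exact right_ne_zero_of_mul h0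
  have hs0 : s' ≠ 0 := left_ne_zero_of_mul h0'
  have ht0 : t' ≠ 0 := left_ne_zero_of_mul (hst' ▸ h0')
  obtain ⟨x₁, y₁, h1, hlcm⟩ := (hR.right_gcd_lcm hst' h0').2
  have hlcm' : ∀ r q, s' * r = t' * q → ∃ z, r = x₁ * z ∧ q = y₁ * z := fun r q hrq => by
    obtain ⟨z, rfl⟩ := hlcm r q hrq
    refine ⟨z, rfl, mul_left_cancel₀ ht0 ?_⟩
    rw [← hrq, ← mul_assoc, h1, mul_assoc]
  obtain ⟨z, rfl, rfl⟩ := hlcm' x y hst'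
  have e1 : s' * (1 - u * s') = t' * (v * s') := by
    have h2 := congrArg (· * s') huv
    simp only [add_mul, one_mul] at h2
    rw [mul_sub, mul_one, ← mul_assoc, ← mul_assoc, sub_eq_iff_eq_add, add_comm]
    exact h2.symm
  have e2 : s' * (u * t') = t' * (1 - v * t') := by
    have h2 := congrArg (· * t') huv
    simp only [add_mul, one_mul] at h2
    rw [mul_sub, mul_one, ← mul_assoc, ← mul_assoc, eq_sub_iff_add_eq]
    exact h2
  obtain ⟨g, hg1, hg2⟩ := hlcm' _ _ e1
  obtain ⟨h, hh1, hh2⟩ := hlcm' _ _ e2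
  have hx0 : x₁ ≠ 0 := left_ne_zero_of_mul (right_ne_zero_of_mul h0')
  refine ⟨z, x₁, y₁, g, h, s', t', rfl, rfl, mul_left_cancel₀ hx0 ?_, h1, fun p q hpq => ?_⟩
  · rw [mul_add, ← mul_assoc, ← mul_assoc, ← hg1, ← hh1, mul_assoc u, ← h1, mul_one]
    noncomm_ring
  · refine ⟨p * u + q * v, ?_⟩
    have h2 : p = p * u * s' + p * (1 - u * s') := by noncomm_ring
    rw [hg1, ← mul_assoc p, hpq, mul_assoc q, ← hg2] at h2
    rw [add_mul, mul_assoc q]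
    exact h2

/-! ### Principal left ideals and atoms -/

section LeftIdeals

variable {R : Type*} [Ring R]

theorem mem_leftIdeal {a x : R} : x ∈ leftIdeal a ↔ ∃ r, r * a = x :=
  Submodule.mem_span_singleton

theorem mul_mem_leftIdeal (r a : R) : r * a ∈ leftIdeal a := mem_leftIdeal.2 ⟨r, rfl⟩

theorem self_mem_leftIdeal (a : R) : a ∈ leftIdeal a := mem_leftIdeal.2 ⟨1, one_mul a⟩

theorem leftIdeal_le {a : R} {I : Submodule R R} : leftIdeal a ≤ I ↔ a ∈ I := by
  simp [leftIdeal, Submodule.span_le]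

theorem mul_right_mem_leftIdeal_mul [IsDomain R] {a b x : R} (hb : b ≠ 0) :
    x * b ∈ leftIdeal (a * b) ↔ x ∈ leftIdeal a := by
  simp_rw [mem_leftIdeal, ← mul_assoc, mul_left_inj' hb]

theorem leftIdeal_eq_top [IsDomain R] {a : R} : leftIdeal a = ⊤ ↔ IsUnit a := by
  rw [Submodule.eq_top_iff', ← forall_const R (b := IsUnit a)]
  constructor
  · intro h _
    obtain ⟨r, hr⟩ := mem_leftIdeal.1 (h 1)
    exact IsUnit.of_mul_eq_one_right r hr
  · intro h x
    obtain ⟨u, rfl⟩ := h 0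
    exact mem_leftIdeal.2 ⟨x * ↑u⁻¹, by simp⟩

theorem eq_top_of_mul_add_mul_eq_one {I : Submodule R R} {x y u v : R} (hx : x ∈ I) (hy : y ∈ I)
    (h : u * x + v * y = 1) : I = ⊤ := by
  rw [Submodule.eq_top_iff']
  intro z
  have : z • (u • x + v • y) ∈ I :=
    I.smul_mem z (I.add_mem (I.smul_mem u hx) (I.smul_mem v hy))
  simpa [h] using this

theorem sup_eq_top_iff {x y : R} :
    leftIdeal x ⊔ leftIdeal y = ⊤ ↔ ∃ u v, u * x + v * y = 1 := by
  constructor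
  · intro h
    have h1 : (1 : R) ∈ leftIdeal x ⊔ leftIdeal y := h ▸ Submodule.mem_top
    obtain ⟨_, hx, _, hy, h⟩ := Submodule.mem_sup.1 h1
    obtain ⟨u, rfl⟩ := mem_leftIdeal.1 hx
    obtain ⟨v, rfl⟩ := mem_leftIdeal.1 hy
    exact ⟨u, v, h⟩
  · rintro ⟨u, v, h⟩
    exact eq_top_of_mul_add_mul_eq_one (Submodule.mem_sup_left (self_mem_leftIdeal x))
      (Submodule.mem_sup_right (self_mem_leftIdeal y)) h

theorem mem_comap_toSpanSingleton {I : Submodule R R} {y r : R} :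
    r ∈ I.comap (LinearMap.toSpanSingleton R R y) ↔ r * y ∈ I := by simp

variable [LeftBezout R]

theorem exists_sup_inf {x y w : R} (hw : w ≠ 0) (hx : w ∈ leftIdeal x) (hy : w ∈ leftIdeal y) :
    (∃ d, leftIdeal x ⊔ leftIdeal y = leftIdeal d) ∧
      ∃ m, leftIdeal x ⊓ leftIdeal y = leftIdeal m := by
  obtain ⟨s, rfl⟩ := mem_leftIdeal.1 hx
  obtain ⟨t, ht⟩ := mem_leftIdeal.1 hy
  obtain ⟨z, x₁, y₁, g, h, s', t', rfl, rfl, h1, h2, h3⟩ :=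
    LeftBezout.exists_coprime ht.symm hw
  have hz : z ≠ 0 := right_ne_zero_of_mul (right_ne_zero_of_mul hw)
  constructor
  · refine ⟨z, le_antisymm (sup_le (leftIdeal_le.2 (mul_mem_leftIdeal _ _))
      (leftIdeal_le.2 (mul_mem_leftIdeal _ _))) (leftIdeal_le.2 ?_)⟩
    refine Submodule.mem_sup.2 ⟨_, mul_mem_leftIdeal g _, _, mul_mem_leftIdeal h _, ?_⟩
    rw [← mul_assoc, ← mul_assoc, ← add_mul, h1, one_mul]
  · refine ⟨s' * (x₁ * z), le_antisymm ?_ (leftIdeal_le.2 ⟨mul_mem_leftIdeal _ _, ?_⟩)⟩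
    · rintro r ⟨hr1, hr2⟩
      obtain ⟨p, rfl⟩ := mem_leftIdeal.1 hr1
      obtain ⟨q, hq⟩ := mem_leftIdeal.1 hr2
      obtain ⟨c, rfl⟩ := h3 p q
        (mul_right_cancel₀ hz (by simpa only [mul_assoc] using hq.symm))
      rw [mul_assoc]
      exact mul_mem_leftIdeal _ _
    · exact mem_leftIdeal.2 ⟨t', by rw [← mul_assoc, ← mul_assoc, h2]⟩

/-- The sum is some `Rd` containing `p`; as `p` is an atom, `Rd` is `Rp` or `R`, and `y ∉ Rp`
excludes the former. -/
theorem exists_mul_add_mul_eq_one {p y w : R} (hp : Irreducible p) (hw : w ≠ 0)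
    (hwp : w ∈ leftIdeal p) (hwy : w ∈ leftIdeal y) (hy : y ∉ leftIdeal p) :
    ∃ u v, u * p + v * y = 1 := by
  rw [← sup_eq_top_iff]
  obtain ⟨d, hd⟩ := (exists_sup_inf hw hwp hwy).1
  have hpd : p ∈ leftIdeal d := hd ▸ Submodule.mem_sup_left (self_mem_leftIdeal p)
  have hyd : y ∈ leftIdeal d := hd ▸ Submodule.mem_sup_right (self_mem_leftIdeal y)
  obtain ⟨r, hr⟩ := mem_leftIdeal.1 hpd
  rcases hp.isUnit_or_isUnit hr.symm with h | h
  · obtain ⟨u, rfl⟩ := h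
    obtain ⟨s, rfl⟩ := mem_leftIdeal.1 hyd
    exact absurd (mem_leftIdeal.2 ⟨s * ↑u⁻¹, by rw [← hr]; simp [mul_assoc]⟩) hy
  · rw [hd, leftIdeal_eq_top.2 h]

/-- The preimage of `R p`, `p` an atom, under right multiplication by `y` is `R` or `R q` with an
atom `q`. -/
theorem exists_irreducible_preimage {p y c : R} (hp : Irreducible p) (hc : c ≠ 0)
    (hcy : c * y ∈ leftIdeal p) (hy : y ∉ leftIdeal p) :
    ∃ q, Irreducible q ∧ ∀ r, r * y ∈ leftIdeal p ↔ r ∈ leftIdeal q := by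
  have hy0 : y ≠ 0 := by
    rintro rfl
    exact hy (Submodule.zero_mem _)
  have hw : c * y ≠ 0 := mul_ne_zero hc hy0
  obtain ⟨m, hm⟩ := (exists_sup_inf hw hcy (mul_mem_leftIdeal c y)).2
  have hmm : m ∈ leftIdeal p ⊓ leftIdeal y := hm ▸ self_mem_leftIdeal m
  obtain ⟨q, rfl⟩ := mem_leftIdeal.1 hmm.2
  have hq : ∀ r, r * y ∈ leftIdeal p ↔ r ∈ leftIdeal q := fun r => by
    rw [← mul_right_mem_leftIdeal_mul (a := q) hy0, ← hm]
    exact ⟨fun h => ⟨h, mul_mem_leftIdeal _ _⟩, fun h => h.1⟩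
  have hm0 : q * y ≠ 0 := by
    rintro h0
    have : c * y ∈ leftIdeal (q * y) := hm ▸ ⟨hcy, mul_mem_leftIdeal _ _⟩
    obtain ⟨r, hr⟩ := mem_leftIdeal.1 this
    exact hw (by rw [← hr, h0, mul_zero])
  have hq0 : q ≠ 0 := left_ne_zero_of_mul hm0
  refine ⟨q, ⟨fun hu => hy ?_, fun q₁ q₂ hqq => ?_⟩, hq⟩
  · have := (hq 1).2 (leftIdeal_eq_top.2 hu ▸ Submodule.mem_top)
    rwa [one_mul] at this
  · subst hqq
    by_cases h2 : q₂ * y ∈ leftIdeal p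
    · left
      obtain ⟨r, hr⟩ := mem_leftIdeal.1 ((hq q₂).1 h2)
      refine IsUnit.of_mul_eq_one_right r
        (mul_right_cancel₀ (right_ne_zero_of_mul hq0) ?_)
      rw [mul_assoc, hr, one_mul]
    · right
      have hmem : q₁ * q₂ * y ∈ leftIdeal (q₂ * y) := by
        rw [mul_assoc]
        exact mul_mem_leftIdeal _ _
      -- From `tp + sq₂y = 1` follows `(1 - ysq₂)y = ytp ∈ Rp`, so `1 - ysq₂ ∈ Rq₁q₂` and `q₂` has a
      -- left inverse.
      obtain ⟨t, s, hts⟩ := exists_mul_add_mul_eq_one hp hm0 hmm.1 hmem h2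
      have h3 : (1 - y * s * q₂) * y ∈ leftIdeal p := by
        refine mem_leftIdeal.2 ⟨y * t, ?_⟩
        rw [mul_assoc, eq_sub_of_add_eq hts]
        noncomm_ring
      obtain ⟨r, hr⟩ := mem_leftIdeal.1 ((hq _).1 h3)
      refine IsUnit.of_mul_eq_one_right (r * q₁ + y * s) ?_
      rw [add_mul, mul_assoc r, hr]
      noncomm_ring

end LeftIdeals

/-! ### Elements of finite length and their factors -/

section Length

variable {R : Type*} [Ring R]

/-- `LengthLE n x`: `x` is a unit or, up to a unit, a product of at most `n` atoms. -/
inductive LengthLE : ℕ → R → Prop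
  | unit {n : ℕ} {x : R} : IsUnit x → LengthLE n x
  | mul {n : ℕ} {x p : R} : LengthLE n x → Irreducible p → LengthLE (n + 1) (x * p)

theorem LengthLE.mul_isUnit {n : ℕ} {x u : R} (h : LengthLE n x) (hu : IsUnit u) :
    LengthLE n (x * u) := by
  cases h with
  | unit hx => exact .unit (hx.mul hu)
  | mul hx hp =>
    rw [mul_assoc]
    exact .mul hx ((irreducible_mul_isUnit hu).2 hp)

theorem LengthLE.mul_lengthLE {m n : ℕ} {x y : R} (hx : LengthLE m x) (hy : LengthLE n y) :
    LengthLE (m + n) (x * y) := by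
  induction hy with
  | @unit n y hu =>
    have := hx.mul_isUnit hu
    clear hu hx
    generalize x * y = z at this
    induction this with
    | unit h => exact .unit h
    | @mul k z p _ hp ih => exact (Nat.add_right_comm k n 1) ▸ .mul ih hp
  | mul _ hp ih =>
    rw [← mul_assoc]
    exact .mul ih hp

theorem LengthLE.mono {m n : ℕ} {x : R} (h : LengthLE m x) (hmn : m ≤ n) : LengthLE n x := by
  obtain ⟨k, rfl⟩ := Nat.exists_eq_add_of_le hmn
  simpa using h.mul_lengthLE (.unit (n := k) isUnit_one)

theorem mem_finiteLength_iff {x : R} : x ∈ finiteLength R ↔ ∃ n, LengthLE n x := by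
  constructor
  · rintro (h | ⟨l, hl, rfl⟩)
    · exact ⟨0, .unit h⟩
    · induction l with
      | nil => exact ⟨0, .unit isUnit_one⟩
      | cons p l ih =>
        obtain ⟨n, hn⟩ := ih fun q hq => hl q (List.mem_cons_of_mem p hq)
        have hp : LengthLE (0 + 1) (1 * p) := .mul (.unit isUnit_one) (hl p List.mem_cons_self)
        rw [one_mul] at hp
        refine ⟨0 + 1 + n, ?_⟩
        rw [List.prod_cons]
        exact hp.mul_lengthLE hn
  · rintro ⟨n, hn⟩
    induction hn with
    | unit h => exact Or.inl h
    | @mul n x p _ hp ih =>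
      right
      rcases ih with hu | ⟨l, hl, rfl⟩
      · exact ⟨[x * p], by simpa using (irreducible_isUnit_mul hu).2 hp, by simp⟩
      · refine ⟨l ++ [p], fun q hq => ?_, by simp⟩
        rcases List.mem_append.1 hq with h | h
        · exact hl q h
        · rw [List.mem_singleton.1 h]
          exact hp

theorem mul_mem_finiteLength {x y : R} (hx : x ∈ finiteLength R) (hy : y ∈ finiteLength R) :
    x * y ∈ finiteLength R := by
  obtain ⟨m, hm⟩ := mem_finiteLength_iff.1 hx
  obtain ⟨n, hn⟩ := mem_finiteLength_iff.1 hy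
  exact mem_finiteLength_iff.2 ⟨_, hm.mul_lengthLE hn⟩

theorem _root_.Irreducible.mem_finiteLength {p : R} (hp : Irreducible p) : p ∈ finiteLength R :=
  Or.inr ⟨[p], by simpa using hp, by simp⟩

theorem LengthLE.ne_zero [IsDomain R] {n : ℕ} {x : R} (h : LengthLE n x) : x ≠ 0 := by
  induction h with
  | unit h => exact h.ne_zero
  | mul _ hp ih => exact mul_ne_zero ih hp.ne_zero

theorem ne_zero_of_mem_finiteLength [IsDomain R] {x : R} (h : x ∈ finiteLength R) : x ≠ 0 :=
  let ⟨_, hn⟩ := mem_finiteLength_iff.1 h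
  hn.ne_zero

variable [LeftBezout R]

/-- Remove the last atom `p` of `x = yp = ab`. If `b ∈ Rp`, cancel `p` from `b`. Otherwise the
preimage of `Rp` under right multiplication by `b` is `Rq` with `q` an atom, so `a = cq`, `qb = b'p`
and `y = cb'`. Here `b'` is not a unit, since otherwise the atom `p` would factor into nonunits. -/
theorem LengthLE.left_factor {n : ℕ} {x : R} (h : LengthLE n x) :
    ∀ {a b : R}, x = a * b → ¬ IsUnit b → ∃ m < n, LengthLE m a := by
  induction h with
  | unit hx =>
    rintro a b rfl hb
    exact absurd (isUnit_of_mul_isUnit_right hx) hb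
  | @mul n y p hy hp ih =>
    intro a b hab hb
    have hw : y * p ≠ 0 := mul_ne_zero hy.ne_zero hp.ne_zero
    by_cases hbp : b ∈ leftIdeal p
    · obtain ⟨b', rfl⟩ := mem_leftIdeal.1 hbp
      have h1 : y = a * b' :=
        mul_right_cancel₀ hp.ne_zero (by rw [hab, mul_assoc])
      by_cases hb' : IsUnit b'
      · obtain ⟨u, rfl⟩ := hb'
        have h2 : a = y * ↑u⁻¹ := by rw [h1]; simp
        exact ⟨n, Nat.lt_succ_self n, h2 ▸ hy.mul_isUnit u⁻¹.isUnit⟩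
      · obtain ⟨m, hm, ha⟩ := ih h1 hb'
        exact ⟨m, by omega, ha⟩
    · have hwb : y * p ∈ leftIdeal b := hab ▸ mul_mem_leftIdeal a b
      have hb0 : b ≠ 0 := right_ne_zero_of_mul (hab ▸ hw)
      have ha0 : a ≠ 0 := left_ne_zero_of_mul (hab ▸ hw)
      obtain ⟨q, hq, hqr⟩ := exists_irreducible_preimage (c := a) hp ha0
        (hab ▸ mul_mem_leftIdeal y p) hbp
      obtain ⟨c, rfl⟩ := mem_leftIdeal.1 ((hqr a).1 (hab ▸ mul_mem_leftIdeal y p))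
      obtain ⟨b', hb'⟩ := mem_leftIdeal.1 ((hqr q).2 (self_mem_leftIdeal q))
      have h1 : y = c * b' := by
        refine mul_right_cancel₀ hp.ne_zero ?_
        rw [hab, mul_assoc, mul_assoc, hb']
      have hb'u : ¬ IsUnit b' := by
        rintro ⟨u, rfl⟩
        have h2 : p = ↑u⁻¹ * q * b := by rw [mul_assoc, ← hb']; simp
        rcases hp.isUnit_or_isUnit h2 with h | h
        · exact hq.not_isUnit (by simpa using h)
        · exact hb h
      obtain ⟨m, hm, hc⟩ := ih h1 hb'u
      exact ⟨m + 1, by omega, hc.mul hq⟩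

/-- The number `k` bounds the length left for `b`. When `b = b₁b₂` with nonunits, it drops for `b₁`
because `ab₁` is shorter than `ab`, and for `b₂` because `ab₁` is longer than `a`. -/
theorem mem_finiteLength_of_lengthLE_mul (k : ℕ) :
    ∀ {n : ℕ} {a b : R}, LengthLE (n + k) (a * b) → (∀ m < n, ¬ LengthLE m a) →
      b ∈ finiteLength R := by
  induction k with
  | zero =>
    intro n a b h hn
    by_contra hb
    obtain ⟨m, hm, ha⟩ := h.left_factor rfl fun hu => hb (Or.inl hu)
    exact hn m hm ha
  | succ k ih =>
    intro n a b h hn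
    by_cases hu : IsUnit b
    · exact Or.inl hu
    by_cases hi : Irreducible b
    · exact hi.mem_finiteLength
    have : ∃ b₁ b₂, b = b₁ * b₂ ∧ ¬ IsUnit b₁ ∧ ¬ IsUnit b₂ := by
      by_contra! hcon
      exact hi ⟨hu, fun b₁ b₂ h12 => or_iff_not_imp_left.2 (hcon b₁ b₂ h12)⟩
    obtain ⟨b₁, b₂, rfl, h1, h2⟩ := this
    rw [← mul_assoc] at h
    refine mul_mem_finiteLength (ih (n := n) (a := a) ?_ hn)
      (ih (n := n + 1) (a := a * b₁) (h.mono (by omega)) fun m hm hab => ?_)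
    · obtain ⟨m, hm, hab⟩ := h.left_factor rfl h2
      exact hab.mono (by omega)
    · obtain ⟨m', hm', ha⟩ := hab.left_factor rfl h1
      exact hn m' (by omega) ha

theorem mem_finiteLength_of_mul {a b : R} (h : a * b ∈ finiteLength R) :
    a ∈ finiteLength R ∧ b ∈ finiteLength R := by
  obtain ⟨n, hn⟩ := mem_finiteLength_iff.1 h
  constructor
  · by_cases hb : IsUnit b
    · obtain ⟨u, rfl⟩ := hb
      have := hn.mul_isUnit u⁻¹.isUnit
      exact mem_finiteLength_iff.2 ⟨n, by simpa using this⟩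
    · obtain ⟨m, -, hm⟩ := hn.left_factor rfl hb
      exact mem_finiteLength_iff.2 ⟨m, hm⟩
  · exact mem_finiteLength_of_lengthLE_mul n (n := 0) (a := a) (by simpa using hn)
      fun m hm => absurd hm (Nat.not_lt_zero m)

end Length

/-! ### Finite intersections of atomic left ideals -/

section AtomMeet

variable {R : Type*} [Ring R]

/-- `I` is a finite intersection of left ideals generated by atoms. -/
def AtomMeet (I : Submodule R R) : Prop :=
  ∃ s : Finset R, (∀ p ∈ s, Irreducible p) ∧ I = ⨅ p ∈ s, leftIdeal p

theorem fullyReducible_iff {f : R} :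
    FullyReducible f ↔ f ∈ finiteLength R ∧ AtomMeet (leftIdeal f) := by
  classical
  refine and_congr_right fun _ => ⟨?_, ?_⟩
  · rintro ⟨n, p, hp, h⟩
    refine ⟨Finset.univ.image p, by simpa using hp, ?_⟩
    rw [h]
    simp only [Finset.mem_image, Finset.mem_univ, true_and, iInf_exists]
    rw [iInf_comm]
    simp only [iInf_iInf_eq_right]
  · rintro ⟨s, hs, h⟩
    refine ⟨s.card, fun i => s.equivFin.symm i, fun i => hs _ (s.equivFin.symm i).2, ?_⟩
    rw [h, s.equivFin.symm.iInf_comp (g := fun p : s => leftIdeal (p : R)), iInf_subtype]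

theorem atomMeet_top : AtomMeet (⊤ : Submodule R R) := ⟨∅, by simp, by simp⟩

theorem AtomMeet.inf {I J : Submodule R R} (hI : AtomMeet I) (hJ : AtomMeet J) :
    AtomMeet (I ⊓ J) := by
  classical
  obtain ⟨s, hs, rfl⟩ := hI
  obtain ⟨t, ht, rfl⟩ := hJ
  refine ⟨s ∪ t, fun p hp => (Finset.mem_union.1 hp).elim (hs p) (ht p), ?_⟩
  rw [Finset.iInf_union]

theorem atomMeet_leftIdeal {p : R} (hp : Irreducible p) : AtomMeet (leftIdeal p) :=
  ⟨{p}, by simpa using hp, by simp⟩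

theorem _root_.Irreducible.fullyReducible {p : R} (hp : Irreducible p) : FullyReducible p :=
  fullyReducible_iff.2 ⟨hp.mem_finiteLength, atomMeet_leftIdeal hp⟩

theorem atomMeet_biInf {ι : Type*} (s : Finset ι) {I : ι → Submodule R R}
    (h : ∀ i ∈ s, AtomMeet (I i)) : AtomMeet (⨅ i ∈ s, I i) := by
  classical
  induction s using Finset.induction with
  | empty => simpa using atomMeet_top
  | insert i s _ ih =>
    rw [Finset.iInf_insert]
    exact (h i (Finset.mem_insert_self i s)).inf
      (ih fun j hj => h j (Finset.mem_insert_of_mem hj))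

variable [LeftBezout R]

theorem AtomMeet.comap {I : Submodule R R} (hI : AtomMeet I) {c y : R} (hc : c ≠ 0)
    (hcy : c * y ∈ I) : AtomMeet (I.comap (LinearMap.toSpanSingleton R R y)) := by
  obtain ⟨s, hs, rfl⟩ := hI
  simp_rw [Submodule.comap_iInf]
  refine atomMeet_biInf s fun p hp => ?_
  by_cases hy : y ∈ leftIdeal p
  · convert atomMeet_top
    rw [Submodule.eq_top_iff']
    exact fun r => mem_comap_toSpanSingleton.2 (Submodule.smul_mem _ r hy)
  · have hcp : c * y ∈ leftIdeal p := by
      simp only [Submodule.mem_iInf] at hcy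
      exact hcy p hp
    obtain ⟨q, hq, hqr⟩ := exists_irreducible_preimage (hs p hp) hc hcp hy
    convert atomMeet_leftIdeal hq
    ext r
    rw [mem_comap_toSpanSingleton, hqr]

/-- If `R f` is a finite intersection of left ideals generated by atoms, then every `R b`
containing it has a complement `R c` over it. -/
theorem exists_complement {b w : R} (hw : w ≠ 0) (hwb : w ∈ leftIdeal b) (s : Finset R)
    (hs : ∀ p ∈ s, Irreducible p) (hws : ∀ p ∈ s, w ∈ leftIdeal p) :
    ∃ c, w ∈ leftIdeal c ∧ leftIdeal b ⊔ leftIdeal c = ⊤ ∧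
      leftIdeal b ⊓ leftIdeal c = leftIdeal b ⊓ ⨅ p ∈ s, leftIdeal p := by
  classical
  induction s using Finset.induction with
  | empty =>
    have h1 : leftIdeal (1 : R) = ⊤ := leftIdeal_eq_top.2 isUnit_one
    exact ⟨1, by simp [h1], by simp [h1], by simp [h1]⟩
  | insert p s _ ih =>
    obtain ⟨c, hwc, hbc, hinf⟩ := ih (fun q hq => hs q (Finset.mem_insert_of_mem hq))
      fun q hq => hws q (Finset.mem_insert_of_mem hq)
    have hp := hs p (Finset.mem_insert_self p s)
    have hwp := hws p (Finset.mem_insert_self p s)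
    have hstep : leftIdeal b ⊓ ⨅ q ∈ insert p s, leftIdeal q =
        leftIdeal b ⊓ leftIdeal c ⊓ leftIdeal p := by
      rw [Finset.iInf_insert, hinf, inf_left_comm, inf_comm, inf_assoc]
    rw [hstep]
    obtain ⟨m, hm⟩ := (exists_sup_inf hw hwb hwc).2
    -- Either `Rp` already contains `Rb ∩ Rc = Rm` and `c` survives, or `Rc` is cut down to `Rc ∩
    -- Rp`. In the second case the modular law gives `Rc = (Rc ∩ Rp) + (Rb ∩ Rc)`, which keeps the
    -- sum with `Rb` equal to `R`.
    by_cases hmp : m ∈ leftIdeal p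
    · refine ⟨c, hwc, hbc, ?_⟩
      rw [hm, inf_eq_left.2 (leftIdeal_le.2 hmp)]
    · obtain ⟨c', hc'⟩ := (exists_sup_inf hw hwc hwp).2
      have hwm : w ∈ leftIdeal m := hm ▸ ⟨hwb, hwc⟩
      have htop : leftIdeal p ⊔ leftIdeal b ⊓ leftIdeal c = ⊤ := by
        rw [hm]
        exact sup_eq_top_iff.2 (exists_mul_add_mul_eq_one hp hw hwp hwm hmp)
      refine ⟨c', hc' ▸ ⟨hwc, hwp⟩, ?_, by rw [← hc', inf_assoc]⟩
      have hmod : leftIdeal c ≤ leftIdeal c ⊓ leftIdeal p ⊔ leftIdeal b ⊓ leftIdeal c := by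
        rw [inf_sup_assoc_of_le _ inf_le_right, htop, inf_top_eq]
      rw [← hc', eq_top_iff, ← hbc]
      exact sup_le le_sup_left (hmod.trans (sup_le le_sup_right (inf_le_left.trans le_sup_left)))

theorem AtomMeet.exists_complement {a b : R} (h : AtomMeet (leftIdeal (a * b))) (h0 : a * b ≠ 0) :
    ∃ c u v, u * b + v * c = 1 ∧ a * b ∈ leftIdeal c ∧
      ∀ r, r ∈ leftIdeal b → r ∈ leftIdeal c → r ∈ leftIdeal (a * b) := by
  obtain ⟨s, hs, h⟩ := h
  have hws : ∀ p ∈ s, a * b ∈ leftIdeal p := fun p hp => by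
    have : a * b ∈ ⨅ p ∈ s, leftIdeal p := h ▸ self_mem_leftIdeal _
    simp only [Submodule.mem_iInf] at this
    exact this p hp
  obtain ⟨c, hc, htop, hinf⟩ := TwoFir.exists_complement h0 (mul_mem_leftIdeal a b) s hs hws
  obtain ⟨u, v, huv⟩ := sup_eq_top_iff.1 htop
  refine ⟨c, u, v, huv, hc, fun r hb hc => ?_⟩
  have hr : r ∈ leftIdeal b ⊓ leftIdeal c := ⟨hb, hc⟩
  rw [hinf, ← h] at hr
  exact hr.2

/-- With `ub + vc = 1`, the element `(1 - bu)b = bvc` lies in `Rb ∩ Rc ⊆ Rab`; cancelling `b` leaves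
`1 - bu ∈ Ra`. -/
theorem AtomMeet.one_mem_leftAddRight {a b : R} (h : AtomMeet (leftIdeal (a * b)))
    (h0 : a * b ≠ 0) : (1 : R) ∈ leftAddRight a b := by
  obtain ⟨c, u, v, huv, -, hinf⟩ := h.exists_complement h0
  have hb : (1 - b * u) * b = b * v * c := by
    have := congrArg (b * ·) huv
    simp only [mul_add, mul_one, ← mul_assoc] at this
    rw [sub_mul, one_mul, sub_eq_iff_eq_add, add_comm]
    exact this.symm
  have h1 := hinf _ (mul_mem_leftIdeal (1 - b * u) b) (hb ▸ mul_mem_leftIdeal _ _)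
  rw [mul_right_mem_leftIdeal_mul (right_ne_zero_of_mul h0)] at h1
  obtain ⟨x, hx⟩ := mem_leftIdeal.1 h1
  exact ⟨x, u, by rw [hx, sub_add_cancel]⟩

/-- Both ideals are preimages of `Rab`: `Ra` under right multiplication by `b`, and `Rb` under right
multiplication by `vc = 1 - ub`, since `rvc` always lies in `Rc` and lies in `Rb` exactly when `r`
does. -/
theorem FullyReducible.of_mul {a b : R} (h : FullyReducible (a * b)) :
    FullyReducible a ∧ FullyReducible b := by
  rw [fullyReducible_iff] at h
  obtain ⟨hF, h⟩ := h
  have h0 := ne_zero_of_mem_finiteLength hF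
  have hb0 := right_ne_zero_of_mul h0
  have hab := mem_finiteLength_of_mul hF
  refine ⟨fullyReducible_iff.2 ⟨hab.1, ?_⟩, fullyReducible_iff.2 ⟨hab.2, ?_⟩⟩
  · convert h.comap (left_ne_zero_of_mul h0) (self_mem_leftIdeal _)
    ext r
    rw [mem_comap_toSpanSingleton, mul_right_mem_leftIdeal_mul hb0]
  · obtain ⟨c, u, v, huv, hc, hinf⟩ := h.exists_complement h0
    have hvc : v * c = 1 - u * b := eq_sub_of_add_eq' huv
    have hmem : ∀ r, r * (v * c) ∈ leftIdeal (a * b) ↔ r ∈ leftIdeal b := fun r => by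
      have h1 : r * (v * c) = r - r * u * b := by rw [hvc, mul_sub, mul_one, mul_assoc]
      have h2 : r * (v * c) ∈ leftIdeal b ↔ r ∈ leftIdeal b := by
        rw [h1, Submodule.sub_mem_iff_left _ (mul_mem_leftIdeal _ _)]
      rw [← h2]
      refine ⟨fun h => leftIdeal_le.2 (mul_mem_leftIdeal a b) h, fun h => hinf _ h ?_⟩
      rw [← mul_assoc]
      exact mul_mem_leftIdeal _ _
    convert h.comap hb0 ((hmem b).2 (self_mem_leftIdeal b))
    ext r
    rw [mem_comap_toSpanSingleton, hmem]

end AtomMeet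

/-! ### The relation `1 ∈ Ra + bR` and direct sum decompositions -/

section Splitting

variable {R : Type*} [Ring R]

theorem idealizer_subset {a b : R} (h : (1 : R) ∈ leftAddRight a b) :
    idealizer a ⊆ leftAddRight a b := by
  obtain ⟨x, y, hxy⟩ := h
  intro f hf
  obtain ⟨g, hg⟩ := mem_leftIdeal.1 hf
  refine ⟨x * g, y * f, ?_⟩
  rw [mul_assoc, hg, ← mul_assoc, ← mul_assoc, ← add_mul, ← hxy, one_mul]

theorem one_mem_idealizer (a : R) : (1 : R) ∈ idealizer a := by
  change a * 1 ∈ leftIdeal a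
  rw [mul_one]
  exact self_mem_leftIdeal a

/-- Send `r` to the classes of `(ry, r)`. Since `by ≡ 1` modulo `Ra`, the multiple `tb` goes to `(t,
0)`; this gives both the kernel and surjectivity. -/
theorem nonempty_quotient_equiv {a b : R} [IsDomain R] (hb : b ≠ 0)
    (h : (1 : R) ∈ leftAddRight a b) :
    Nonempty ((R ⧸ leftIdeal (a * b)) ≃ₗ[R] (R ⧸ leftIdeal a) × (R ⧸ leftIdeal b)) := by
  obtain ⟨x, y, hxy⟩ := h
  let f : R →ₗ[R] (R ⧸ leftIdeal a) × (R ⧸ leftIdeal b) :=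
    ((leftIdeal a).mkQ.comp (LinearMap.toSpanSingleton R R y)).prod (leftIdeal b).mkQ
  have hf : ∀ r, f r = ((leftIdeal a).mkQ (r * y), (leftIdeal b).mkQ r) := fun r => rfl
  have hby : b * y = 1 - x * a := eq_sub_of_add_eq' hxy.symm
  have hmem : ∀ t, t * b * y - t ∈ leftIdeal a := fun t => by
    rw [mul_assoc, hby]
    exact mem_leftIdeal.2 ⟨-(t * x), by noncomm_ring⟩
  have hker : LinearMap.ker f = leftIdeal (a * b) := by
    ext r
    rw [LinearMap.mem_ker, hf, Prod.mk_eq_zero, Submodule.mkQ_apply, Submodule.mkQ_apply,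
      Submodule.Quotient.mk_eq_zero, Submodule.Quotient.mk_eq_zero]
    constructor
    · rintro ⟨h1, h2⟩
      obtain ⟨t, rfl⟩ := mem_leftIdeal.1 h2
      rw [mul_right_mem_leftIdeal_mul hb]
      simpa using Submodule.sub_mem _ h1 (hmem t)
    · intro hr
      obtain ⟨t, rfl⟩ := mem_leftIdeal.1 hr
      rw [← mul_assoc]
      refine ⟨?_, mul_mem_leftIdeal _ _⟩
      simpa using Submodule.add_mem _ (hmem (t * a)) (mul_mem_leftIdeal t a)
  have hsurj : Function.Surjective f := by
    rintro ⟨α, β⟩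
    obtain ⟨α, rfl⟩ := (leftIdeal a).mkQ_surjective α
    obtain ⟨β, rfl⟩ := (leftIdeal b).mkQ_surjective β
    refine ⟨β + (α - β * y) * b, Prod.ext ?_ ?_⟩
    · simp only [hf, Submodule.mkQ_apply]
      rw [Submodule.Quotient.eq]
      convert hmem (α - β * y) using 1
      noncomm_ring
    · simp only [hf, Submodule.mkQ_apply]
      rw [Submodule.Quotient.eq]
      exact mem_leftIdeal.2 ⟨α - β * y, by noncomm_ring⟩
  exact ⟨(Submodule.quotEquivOfEq _ _ hker.symm).trans (f.quotKerEquivOfSurjective hsurj)⟩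

variable [LeftBezout R]

/-- `Rab` is the annihilator of the class of 1. If `e` sends that class to `(y, z)`, this
annihilator is the intersection of the preimages of `Ra` under `y` and of `Rb` under `z`. -/
theorem FullyReducible.mul_of_quotient_equiv {a b : R} (ha : FullyReducible a)
    (hb : FullyReducible b)
    (e : (R ⧸ leftIdeal (a * b)) ≃ₗ[R] (R ⧸ leftIdeal a) × (R ⧸ leftIdeal b)) :
    FullyReducible (a * b) := by
  rw [fullyReducible_iff] at ha hb ⊢
  have hF := mul_mem_finiteLength ha.1 hb.1
  have h0 := ne_zero_of_mem_finiteLength hF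
  refine ⟨hF, ?_⟩
  obtain ⟨y, hy⟩ := (leftIdeal a).mkQ_surjective (e ((leftIdeal (a * b)).mkQ 1)).1
  obtain ⟨z, hz⟩ := (leftIdeal b).mkQ_surjective (e ((leftIdeal (a * b)).mkQ 1)).2
  have hmem : ∀ r, r ∈ leftIdeal (a * b) ↔ r * y ∈ leftIdeal a ∧ r * z ∈ leftIdeal b := by
    intro r
    have h1 : e ((leftIdeal (a * b)).mkQ r) =
        ((leftIdeal a).mkQ (r * y), (leftIdeal b).mkQ (r * z)) := by
      have : r = r • (1 : R) := by simp
      conv_lhs => rw [this, map_smul, map_smul]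
      refine Prod.ext ?_ ?_
      · rw [Prod.smul_fst, ← hy, ← map_smul, smul_eq_mul]
      · rw [Prod.smul_snd, ← hz, ← map_smul, smul_eq_mul]
    rw [← Submodule.Quotient.mk_eq_zero, ← Submodule.mkQ_apply, ← e.map_eq_zero_iff, h1,
      Prod.mk_eq_zero, Submodule.mkQ_apply, Submodule.mkQ_apply,
      Submodule.Quotient.mk_eq_zero, Submodule.Quotient.mk_eq_zero]
  have hself := (hmem (a * b)).1 (self_mem_leftIdeal _)
  convert (ha.2.comap h0 hself.1).inf (hb.2.comap h0 hself.2)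
  ext r
  rw [Submodule.mem_inf, mem_comap_toSpanSingleton, mem_comap_toSpanSingleton, hmem]

theorem FullyReducible.mul_of_one_mem {a b : R} (ha : FullyReducible a) (hb : FullyReducible b)
    (h : (1 : R) ∈ leftAddRight a b) : FullyReducible (a * b) :=
  let ⟨e⟩ := nonempty_quotient_equiv (ne_zero_of_mem_finiteLength hb.1) h
  ha.mul_of_quotient_equiv hb e

theorem FullyReducible.one_mem_leftAddRight {a b : R} (h : FullyReducible (a * b)) :
    (1 : R) ∈ leftAddRight a b :=
  (fullyReducible_iff.1 h).2.one_mem_leftAddRight (ne_zero_of_mem_finiteLength h.1)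

/-- If `1 ∈ R p + q R` for all left atomic factors `q` of a fully reducible `b`, then
`1 ∈ R p + b R`. -/
theorem one_mem_leftAddRight_of_forall_atom {p : R} {n : ℕ} :
    ∀ {b : R}, LengthLE n b → FullyReducible b → (∀ q ∈ V' b, (1 : R) ∈ leftAddRight p q) →
      (1 : R) ∈ leftAddRight p b := by
  induction n using Nat.strong_induction_on with
  | _ n ih =>
    intro b hn hb hV
    have h0 := ne_zero_of_mem_finiteLength hb.1
    rcases hb.1 with ⟨u, rfl⟩ | ⟨_ | ⟨q, l⟩, hl, rfl⟩
    · exact ⟨0, ↑u⁻¹, by simp⟩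
    · exact ⟨0, 1, by simp⟩
    · rw [List.prod_cons] at hn hb hV h0 ⊢
      generalize l.prod = c at hn hb hV h0 ⊢
      have hq : Irreducible q := hl q List.mem_cons_self
      have hc0 : c ≠ 0 := right_ne_zero_of_mul h0
      obtain ⟨e, u, v, huv, he, hinf⟩ := (fullyReducible_iff.1 hb).2.exists_complement h0
      obtain ⟨b', hb'⟩ := mem_leftIdeal.1 he
      have he0 : e ≠ 0 := right_ne_zero_of_mul (hb' ▸ h0)
      have hcv : (1 - c * u) * c = c * v * e := by
        have := congrArg (c * ·) huv
        simp only [mul_add, mul_one, ← mul_assoc] at this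
        rw [sub_mul, one_mul, sub_eq_iff_eq_add, add_comm]
        exact this.symm
      have heu : (1 - e * v) * e = e * u * c := by
        have := congrArg (e * ·) huv
        simp only [mul_add, mul_one, ← mul_assoc] at this
        rw [sub_mul, one_mul, sub_eq_iff_eq_add]
        exact this.symm
      obtain ⟨g, hg⟩ := mem_leftIdeal.1
        (hinf _ (mul_mem_leftIdeal (1 - c * u) c) (hcv ▸ mul_mem_leftIdeal _ _))
      obtain ⟨k, hk⟩ := mem_leftIdeal.1
        (hinf _ (heu ▸ mul_mem_leftIdeal _ _) (mul_mem_leftIdeal (1 - e * v) e))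
      have hg1 : g * q = 1 - c * u := mul_right_cancel₀ hc0 (by rw [mul_assoc, hg])
      have hg2 : g * b' = c * v := mul_right_cancel₀ he0 (by rw [mul_assoc, hb', hg, hcv])
      have hk1 : k * q = e * u := mul_right_cancel₀ hc0 (by rw [mul_assoc, hk, heu])
      -- The two factorizations `b = qc = b'e` come from complementary `Rc` and `Re`, which makes
      -- the left factors `q` and `b'` right comaximal.
      have hcop : b' * k + q * g = 1 := by
        refine mul_right_cancel₀ hq.ne_zero ?_
        rw [add_mul, mul_assoc, mul_assoc, hk1, hg1, ← mul_assoc, hb']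
        noncomm_ring
      have heu' : ¬ IsUnit e := by
        intro hunit
        have h1 : c ∈ leftIdeal (q * c) :=
          hinf c (self_mem_leftIdeal c) (leftIdeal_eq_top.2 hunit ▸ Submodule.mem_top)
        obtain ⟨r, hr⟩ := mem_leftIdeal.1 h1
        refine hq.not_isUnit (IsUnit.of_mul_eq_one_right r (mul_right_cancel₀ hc0 ?_))
        rw [mul_assoc, hr, one_mul]
      obtain ⟨m, hm, hmb⟩ := hn.left_factor hb'.symm heu'
      obtain ⟨α, β, hαβ⟩ := hV q ⟨hq, c, rfl⟩
      obtain ⟨α', β', hαβ'⟩ := ih m hm hmb (hb' ▸ hb : FullyReducible (b' * e)).of_mul.1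
        fun r hr => by
          obtain ⟨hr, d, rfl⟩ := hr
          exact hV r ⟨hr, d * e, by rw [← hb', mul_assoc]⟩
      -- Weight `αp + qβ = 1` by `b'k` and `α'p + b'β' = 1` by `qg`. The terms outside `Rp` are
      -- `b'kqβ = b'euβ` and `qgb'β' = qcvβ'`, both in `bR` because `b'e = qc = b`.
      refine ⟨b' * k * α + q * g * α', u * β + v * β', ?_⟩
      have h1 : α * p = 1 - q * β := eq_sub_of_add_eq hαβ.symm
      have h2 : α' * p = 1 - b' * β' := eq_sub_of_add_eq hαβ'.symm
      have h3 : b' * (k * q) * β = q * c * u * β := by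
        rw [hk1, ← mul_assoc, hb']
      have h4 : q * (g * b') * β' = q * c * v * β' := by
        rw [hg2, ← mul_assoc]
      calc (1 : R) = b' * k + q * g - b' * (k * q) * β - q * (g * b') * β'
            + q * c * u * β + q * c * v * β' := by rw [hcop, h3, h4]; abel
        _ = b' * k * (1 - q * β) + q * g * (1 - b' * β') + q * c * (u * β + v * β') := by
          noncomm_ring
        _ = _ := by rw [← h1, ← h2]; noncomm_ring

end Splitting

/-! ### `F`-bases of `V(a)` -/

section Basis

variable {R : Type*} [Ring R]

theorem FAlgebraic.mono {Δ Δ' : Set R} (h : FAlgebraic Δ') (hs : Δ ⊆ Δ') : FAlgebraic Δ :=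
  ⟨fun δ hδ => h.1 δ (hs hδ), fun h0 => h.2 (le_bot_iff.1 (h0 ▸ biInf_mono hs))⟩

theorem mem_iInf_leftIdeal_of_subset_V {a : R} {s : Finset R} (hs : (s : Set R) ⊆ V a) :
    a ∈ ⨅ p ∈ s, leftIdeal p := by
  simp only [Submodule.mem_iInf]
  exact fun p hp => (hs hp).2

theorem fAlgebraic_V {a : R} (ha : a ≠ 0) : FAlgebraic (V a) := by
  refine ⟨fun p hp => ⟨hp.1.mem_finiteLength, hp.1.not_isUnit⟩, fun h => ha ?_⟩
  rw [← Submodule.mem_bot R, ← h]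
  simp only [Submodule.mem_iInf]
  exact fun p hp => hp.2

theorem AtomMeet.exists_subset_V {a : R} (h : AtomMeet (leftIdeal a)) :
    ∃ s : Finset R, (s : Set R) ⊆ V a ∧ leftIdeal a = ⨅ p ∈ s, leftIdeal p := by
  obtain ⟨s, hs, h⟩ := h
  refine ⟨s, fun p hp => ⟨hs p hp, ?_⟩, h⟩
  have : a ∈ ⨅ p ∈ s, leftIdeal p := h ▸ self_mem_leftIdeal a
  simp only [Submodule.mem_iInf] at this
  exact this p hp

variable [LeftBezout R]

theorem exists_iInf_eq_leftIdeal {a : R} (ha : a ≠ 0) {s : Finset R} (hs : (s : Set R) ⊆ V a) :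
    ∃ m, ⨅ p ∈ s, leftIdeal p = leftIdeal m := by
  classical
  induction s using Finset.induction with
  | empty => exact ⟨1, by simp [leftIdeal_eq_top.2 isUnit_one]⟩
  | insert p s _ ih =>
    rw [Finset.coe_insert, Set.insert_subset_iff] at hs
    obtain ⟨m, hm⟩ := ih hs.2
    rw [Finset.iInf_insert, hm]
    exact (exists_sup_inf ha hs.1.2 (hm ▸ mem_iInf_leftIdeal_of_subset_V hs.2)).2

/-- The intersection is principal and contains `a ≠ 0`, so the dichotomy for the atom `d` applies.
Dependence inside `V(a)` thus becomes plain containment. -/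
theorem sup_iInf_ne_top_iff {a d : R} (ha : a ≠ 0) (hd : d ∈ V a) {s : Finset R}
    (hs : (s : Set R) ⊆ V a) :
    leftIdeal d ⊔ (⨅ p ∈ s, leftIdeal p) ≠ ⊤ ↔ ⨅ p ∈ s, leftIdeal p ≤ leftIdeal d := by
  obtain ⟨m, hm⟩ := exists_iInf_eq_leftIdeal ha hs
  have ham : a ∈ leftIdeal m := hm ▸ mem_iInf_leftIdeal_of_subset_V hs
  rw [hm]
  constructor
  · intro h
    by_contra hmd
    rw [leftIdeal_le] at hmd
    exact h (sup_eq_top_iff.2 (exists_mul_add_mul_eq_one hd.1 ha hd.2 ham hmd))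
  · intro h
    rw [sup_eq_left.2 h]
    exact fun h => hd.1.not_isUnit (leftIdeal_eq_top.1 h)

theorem fDependent_iff {a d : R} (ha : a ≠ 0) (hd : d ∈ V a) {B : Set R} (hB : B ⊆ V a) :
    FDependent d B ↔
      ∃ s : Finset R, (s : Set R) ⊆ B ∧ ⨅ p ∈ s, leftIdeal p ≤ leftIdeal d := by
  constructor
  · rintro ⟨-, -, s, hs, h⟩
    exact ⟨s, hs, (sup_iInf_ne_top_iff ha hd (hs.trans hB)).1 h⟩
  · rintro ⟨s, hs, h⟩
    exact ⟨hd.1.mem_finiteLength,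
      (fAlgebraic_V ha).mono (Set.union_subset hB (Set.singleton_subset_iff.2 hd)), s, hs,
      (sup_iInf_ne_top_iff ha hd (hs.trans hB)).2 h⟩

/-- A minimal finite subset of `V(a)` cutting out `Ra` is a basis: an element dependent on the
others could be erased. -/
theorem FullyReducible.exists_isFBasis {a : R} (h : FullyReducible a) :
    ∃ B, IsFBasis B (V a) := by
  classical
  have ha := ne_zero_of_mem_finiteLength h.1
  obtain ⟨s, ⟨hs, hsa⟩, hmin⟩ := WellFounded.has_min
    (wellFounded_lt : WellFounded ((· < ·) : Finset R → Finset R → Prop))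
    {s : Finset R | (s : Set R) ⊆ V a ∧ leftIdeal a = ⨅ p ∈ s, leftIdeal p}
    (fullyReducible_iff.1 h).2.exists_subset_V
  refine ⟨s, fAlgebraic_V ha, hs, ⟨(fAlgebraic_V ha).mono hs, fun d hd hdep => ?_⟩,
    fun d hd => (fDependent_iff ha hd hs).2 ⟨s, le_rfl, ?_⟩⟩
  · obtain ⟨t, ht, htd⟩ := (fDependent_iff ha (hs hd) (Set.sdiff_subset.trans hs)).1 hdep
    refine hmin (s.erase d) ⟨(Finset.coe_subset.2 (s.erase_subset d)).trans hs, ?_⟩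
      (Finset.erase_ssubset hd)
    have hts : t ⊆ s.erase d := fun x hx =>
      Finset.mem_erase.2 ⟨(ht hx).2, (ht hx).1⟩
    have hle : ⨅ p ∈ s.erase d, leftIdeal p ≤ leftIdeal d := (biInf_mono hts).trans htd
    rw [hsa, ← Finset.insert_erase hd, Finset.iInf_insert, Finset.erase_insert_eq_erase,
      Finset.erase_idem, inf_eq_right.2 hle]
  · rw [← hsa]
    exact leftIdeal_le.2 hd.2

/-- Each of the finitely many atoms cutting out `Ra` depends on a finite part of `B`; the union of
these parts serves. -/
theorem IsFBasis.exists_finset {a : R} (h : FullyReducible a) {B : Set R}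
    (hB : IsFBasis B (V a)) :
    ∃ s : Finset R, (s : Set R) ⊆ B ∧ leftIdeal a = ⨅ p ∈ s, leftIdeal p := by
  classical
  have ha := ne_zero_of_mem_finiteLength h.1
  obtain ⟨t, ht, hta⟩ := (fullyReducible_iff.1 h).2.exists_subset_V
  choose! f hf hfd using fun d hd => (fDependent_iff ha hd hB.2.1).1 (hB.2.2.2 d hd)
  have hsub : ((t.biUnion f : Finset R) : Set R) ⊆ B := fun x hx => by
    obtain ⟨d, hd, hx⟩ := Finset.mem_biUnion.1 hx
    exact hf d (ht hd) hx
  refine ⟨t.biUnion f, hsub, le_antisymm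
    (leftIdeal_le.2 (mem_iInf_leftIdeal_of_subset_V (hsub.trans hB.2.1))) ?_⟩
  rw [hta]
  refine le_iInf₂ fun d hd => le_trans ?_ (hfd d (ht hd))
  exact biInf_mono fun x hx => Finset.mem_biUnion.2 ⟨d, hd, hx⟩

theorem FullyReducible.mul_of_isFBasis {a b : R} (ha : FullyReducible a) (hb : FullyReducible b)
    {B : Set R} (hB : IsFBasis B (V a)) (h : ∀ p ∈ B, FullyReducible (p * b)) :
    FullyReducible (a * b) := by
  obtain ⟨s, hs, hsa⟩ := hB.exists_finset ha
  have hb0 := ne_zero_of_mem_finiteLength hb.1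
  refine fullyReducible_iff.2 ⟨mul_mem_finiteLength ha.1 hb.1, ?_⟩
  -- The extra term `Rb` keeps the formula for `Rab` correct when `s` is empty.
  convert (fullyReducible_iff.1 hb).2.inf
    (atomMeet_biInf s fun p hp => (fullyReducible_iff.1 (h p (hs hp))).2)
  ext r
  rw [Submodule.mem_inf]
  simp only [Submodule.mem_iInf]
  have key : ∀ t, t * b ∈ leftIdeal (a * b) ↔ ∀ p ∈ s, t * b ∈ leftIdeal (p * b) := fun t => by
    simp_rw [mul_right_mem_leftIdeal_mul hb0, hsa, Submodule.mem_iInf]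
  constructor
  · intro hr
    obtain ⟨t, rfl⟩ := mem_leftIdeal.1 (leftIdeal_le.2 (mul_mem_leftIdeal a b) hr)
    exact ⟨mul_mem_leftIdeal t b, (key t).1 hr⟩
  · rintro ⟨hr, h⟩
    obtain ⟨t, rfl⟩ := mem_leftIdeal.1 hr
    exact (key t).2 h

end Basis

end TwoFir

theorem mainTheorem6 {R : Type*} [Ring R] (hR : TwoFir.IsTwoFir R)
    (a b : R) (ha : ¬ IsUnit a) (hb : ¬ IsUnit b) :
    List.TFAE [
      TwoFir.FullyReducible (a * b),
      TwoFir.FullyReducible a ∧ TwoFir.FullyReducible b ∧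
        Nonempty ((R ⧸ TwoFir.leftIdeal (a * b)) ≃ₗ[R]
          (R ⧸ TwoFir.leftIdeal a) × (R ⧸ TwoFir.leftIdeal b)),
      TwoFir.FullyReducible a ∧ TwoFir.FullyReducible b ∧
        (1 : R) ∈ TwoFir.leftAddRight a b,
      TwoFir.FullyReducible a ∧ TwoFir.FullyReducible b ∧
        ∀ p ∈ TwoFir.V a, TwoFir.FullyReducible (p * b),
      TwoFir.FullyReducible a ∧ TwoFir.FullyReducible b ∧
        ∀ B : Set R, TwoFir.IsFBasis B (TwoFir.V a) →
          ∀ p ∈ B, TwoFir.FullyReducible (p * b),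
      TwoFir.FullyReducible a ∧ TwoFir.FullyReducible b ∧
        ∃ B : Set R, TwoFir.IsFBasis B (TwoFir.V a) ∧
          ∀ p ∈ B, TwoFir.FullyReducible (p * b),
      TwoFir.FullyReducible a ∧ TwoFir.FullyReducible b ∧
        ∀ p ∈ TwoFir.V a, ∀ q ∈ TwoFir.V' b, TwoFir.FullyReducible (p * q),
      TwoFir.FullyReducible a ∧ TwoFir.FullyReducible b ∧
        TwoFir.idealizer a ⊆ TwoFir.leftAddRight a b] := by
  have := hR.leftBezout
  tfae_have 1 → 3 := fun h => ⟨h.of_mul.1, h.of_mul.2, h.one_mem_leftAddRight⟩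
  tfae_have 3 → 2 := fun ⟨h1, h2, h⟩ =>
    ⟨h1, h2, TwoFir.nonempty_quotient_equiv (TwoFir.ne_zero_of_mem_finiteLength h2.1) h⟩
  tfae_have 2 → 1 := fun ⟨h1, h2, ⟨e⟩⟩ => h1.mul_of_quotient_equiv h2 e
  tfae_have 3 → 8 := fun ⟨h1, h2, h⟩ => ⟨h1, h2, TwoFir.idealizer_subset h⟩
  tfae_have 8 → 3 := fun ⟨h1, h2, h⟩ => ⟨h1, h2, h (TwoFir.one_mem_idealizer a)⟩
  -- The product `pq` is a middle factor of `ab = a'(pq)b'`.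
  tfae_have 1 → 7 := by
    refine fun h => ⟨h.of_mul.1, h.of_mul.2, fun p hp q hq => ?_⟩
    obtain ⟨a', rfl⟩ := TwoFir.mem_leftIdeal.1 hp.2
    obtain ⟨-, b', rfl⟩ := hq
    rw [mul_assoc, ← mul_assoc p] at h
    exact h.of_mul.2.of_mul.1
  tfae_have 7 → 4 := by
    refine fun ⟨h1, h2, h⟩ => ⟨h1, h2, fun p hp => ?_⟩
    obtain ⟨n, hn⟩ := TwoFir.mem_finiteLength_iff.1 h2.1
    exact hp.1.fullyReducible.mul_of_one_mem h2
      (TwoFir.one_mem_leftAddRight_of_forall_atom hn h2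
        fun q hq => (h p hp q hq).one_mem_leftAddRight)
  tfae_have 4 → 5 := fun ⟨h1, h2, h⟩ => ⟨h1, h2, fun B hB p hp => h p (hB.2.1 hp)⟩
  tfae_have 5 → 6 := fun ⟨h1, h2, h⟩ =>
    let ⟨B, hB⟩ := h1.exists_isFBasis
    ⟨h1, h2, B, hB, h B hB⟩
  tfae_have 6 → 1 := fun ⟨h1, h2, B, hB, h⟩ => h1.mul_of_isFBasis h2 hB h
  tfae_finish
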